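/- Let $0<r<1<R$, let $\varphi$ be injective and holomorphic on the annulus $\{z\in\mathbb C: r<|z|<R\}$, and let $\gamma(t)=\varphi(e^{it})$, $t\in\mathbb R$, be the corresponding analytic Jordan curve, with trace $\gamma^*=\gamma(\mathbb R)$. (For instance, $\varphi$ may be a Riemann map of the unit disk onto the interior of an analytic Jordan curve, extended conformally to a neighbourhood of the closed disk.) For $k\in\{0,1,2,\dots\}\cup\{\infty\}$ let $C^k(\gamma^*)$ be the space of functions $f:\gamma^*\to\mathbb C$ such that $t\mapsto f(\gamma(t))$ is $k$ times continuously differentiable on $\mathbb R$ (infinitely differentiable if $k=\infty$), with the topology defined by the seminorms $$\sup_{t\in\mathbb R}\bigl|(f\circ\gamma)^{(l)}(t)\bigr|,\qquad l\in\{0,1,2,\dots\},\ l\le k.$$ A function $f:\gamma^*\to\mathbb C$ is *real analytic at* $\gamma(t_0)$ if there are a power series $\sum_{n\ge 0}a_n(t-t_0)^n$, $a_n\in\mathbb C$, with radius of convergence $\rho>0$ and a $\delta\in(0,\rho]$ such that $f(\gamma(t))=\sum_{n\ge 0}a_n(t-t_0)^n$ for $|t-t_0|<\delta$. It is *extendable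 at* $\gamma(t_0)$ if there are an open set $V\subseteq\mathbb C$ with $\gamma(t_0)\in V$ and a holomorphic $F:V\to\mathbb C$ with $F=f$ on $V\cap\gamma^*$. Then: 1. for every $f:\gamma^*\to\mathbb C$ and every $t_0\in\mathbb R$, $f$ is real analytic at $\gamma(t_0)$ if and only if $f$ is extendable at $\gamma(t_0)$; 2. for every $k=0,1,2,\dots,\infty$, the set of all $f\in C^k(\gamma^*)$ that are real analytic at no point of $\gamma^*$ is a dense $G_\delta$ subset of $C^k(\gamma^*)$. -/

import Mathlib

open Set Topology
open scoped ContDiff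

noncomputable section

namespace JordanCk

/-- `φ` is injective and holomorphic on an annulus `{r < |z| < R}`, `0 < r < 1 < R`, so that
`t ↦ φ (e^{it})` is an analytic Jordan curve.  Nothing is asked of `φ` off the annulus. -/
def IsAnalyticJordan (φ : ℂ → ℂ) : Prop :=
  ∃ r R : ℝ, 0 < r ∧ r < 1 ∧ 1 < R ∧
    DifferentiableOn ℂ φ {z : ℂ | r < ‖z‖ ∧ ‖z‖ < R} ∧
    InjOn φ {z : ℂ | r < ‖z‖ ∧ ‖z‖ < R}

/-- The `2π`-periodic parametrization `γ(t) = φ (e^{it})`. -/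
def curve (φ : ℂ → ℂ) (t : ℝ) : ℂ := φ (Complex.exp (t * Complex.I))

/-- The trace `γ*` of the curve. -/
def trace (φ : ℂ → ℂ) : Set ℂ := range (curve φ)

/-- The function `t ↦ f (γ t)` of the parameter. -/
def pull (φ : ℂ → ℂ) (f : trace φ → ℂ) (t : ℝ) : ℂ := f ⟨curve φ t, mem_range_self t⟩

/-- The functions on `γ*` that are `k` times continuously differentiable in the parameter
(`k = ⊤` means infinitely differentiable), as a vector space. -/
def ckSubmodule (φ : ℂ → ℂ) (k : ℕ∞) : Submodule ℂ (trace φ → ℂ) where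
  carrier := {f | ContDiff ℝ k (pull φ f)}
  zero_mem' := by
    change ContDiff ℝ k fun _ : ℝ => (0 : ℂ)
    exact contDiff_const
  add_mem' := by
    intro f g hf hg
    change ContDiff ℝ k fun t => pull φ f t + pull φ g t
    exact ContDiff.add hf hg
  smul_mem' := by
    intro c f hf
    change ContDiff ℝ k fun t => c • pull φ f t
    exact ContDiff.const_smul c hf

/-- The space `C^k(γ*)`.  It is a type of its own, so that it does not inherit the topology of
pointwise convergence. -/
def Ck (φ : ℂ → ℂ) (k : ℕ∞) : Type := ckSubmodule φ k

instance (φ : ℂ → ℂ) (k : ℕ∞) : AddCommGroup (Ck φ k) :=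
  inferInstanceAs (AddCommGroup (ckSubmodule φ k))

instance (φ : ℂ → ℂ) (k : ℕ∞) : Module ℂ (Ck φ k) :=
  inferInstanceAs (Module ℂ (ckSubmodule φ k))

/-- The function on `γ*` underlying an element of `C^k(γ*)`. -/
def Ck.fn {φ : ℂ → ℂ} {k : ℕ∞} (f : Ck φ k) : trace φ → ℂ := Subtype.val f

theorem Ck.contDiff {φ : ℂ → ℂ} {k : ℕ∞} (f : Ck φ k) : ContDiff ℝ k (pull φ f.fn) :=
  Subtype.property f

theorem curve_periodic (φ : ℂ → ℂ) : Function.Periodic (curve φ) (2 * Real.pi) := by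
  intro t
  have h : Complex.exp (((t + 2 * Real.pi : ℝ) : ℂ) * Complex.I)
      = Complex.exp (t * Complex.I) := by
    rw [Complex.exp_eq_exp_iff_exists_int]
    exact ⟨1, by push_cast; ring⟩
  simp only [curve, h]

theorem pull_periodic (φ : ℂ → ℂ) (f : trace φ → ℂ) :
    Function.Periodic (pull φ f) (2 * Real.pi) := by
  intro t
  exact congrArg f (Subtype.ext (curve_periodic φ t))

theorem bddAbove_deriv {φ : ℂ → ℂ} {k : ℕ∞} (f : Ck φ k) {l : ℕ} (hl : (l : ℕ∞) ≤ k) :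
    BddAbove (range fun t : ℝ => ‖iteratedDeriv l (pull φ f.fn) t‖) := by
  have hc : Continuous fun t : ℝ => ‖iteratedDeriv l (pull φ f.fn) t‖ :=
    (f.contDiff.continuous_iteratedDeriv l (by exact_mod_cast hl)).norm
  have hp : Function.Periodic (fun t : ℝ => ‖iteratedDeriv l (pull φ f.fn) t‖)
      (2 * Real.pi) := by
    intro t
    have h := iteratedDeriv_comp_add_const l (pull φ f.fn) (2 * Real.pi)
    rw [show (fun z => pull φ f.fn (z + 2 * Real.pi)) = pull φ f.fn from
      funext (pull_periodic φ f.fn)] at h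
    exact congrArg norm (congrFun h t).symm
  exact (hp.compact_of_continuous Real.two_pi_pos.ne' hc).bddAbove

/-- The seminorm `f ↦ sup_{t ∈ ℝ} |(f ∘ γ)^{(l)}(t)|` on `C^k(γ*)`, for `l ≤ k`. -/
def ckSeminorm (φ : ℂ → ℂ) (k : ℕ∞) (l : {l : ℕ // (l : ℕ∞) ≤ k}) : Seminorm ℂ (Ck φ k) :=
  Seminorm.of (fun f => ⨆ t : ℝ, ‖iteratedDeriv l (pull φ f.fn) t‖)
    (by
      intro f g
      refine ciSup_le fun t => ?_
      have hle : ((l : ℕ) : WithTop ℕ∞) ≤ (k : WithTop ℕ∞) := by exact_mod_cast l.2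
      have h : iteratedDeriv l (pull φ (f + g).fn) t
          = iteratedDeriv l (pull φ f.fn) t + iteratedDeriv l (pull φ g.fn) t :=
        iteratedDeriv_add (f.contDiff.of_le hle).contDiffAt (g.contDiff.of_le hle).contDiffAt
      rw [h]
      exact (norm_add_le _ _).trans
        (add_le_add (le_ciSup (bddAbove_deriv f l.2) t) (le_ciSup (bddAbove_deriv g l.2) t)))
    (by
      intro c f
      have hle : ((l : ℕ) : WithTop ℕ∞) ≤ (k : WithTop ℕ∞) := by exact_mod_cast l.2
      have h : ∀ t, iteratedDeriv l (pull φ (c • f).fn) t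
          = c • iteratedDeriv l (pull φ f.fn) t := fun t =>
        iteratedDeriv_const_smul (f.contDiff.of_le hle).contDiffAt c
      simp only [h, norm_smul]
      exact (Real.mul_iSup_of_nonneg (norm_nonneg c) _).symm)

instance (k : ℕ∞) : Nonempty {l : ℕ // (l : ℕ∞) ≤ k} := ⟨⟨0, by simp⟩⟩

/-- The topology of `C^k(γ*)`: the locally convex one given by the seminorms
`sup_t |(f ∘ γ)^{(l)}(t)|`, `l ≤ k` (all `l` if `k = ⊤`). -/
instance (φ : ℂ → ℂ) (k : ℕ∞) : TopologicalSpace (Ck φ k) :=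
  (SeminormFamily.moduleFilterBasis (𝕜 := ℂ) (ckSeminorm φ k)).topology

/-- `f` is real analytic at `γ(t₀)`: `f (γ t)` is the sum of a power series in `t - t₀` with
complex coefficients and positive radius of convergence, for `t` near `t₀`. -/
def RealAnalyticAt (φ : ℂ → ℂ) (f : trace φ → ℂ) (t₀ : ℝ) : Prop :=
  AnalyticAt ℝ (pull φ f) t₀

/-- `f` is extendable at `γ(t₀)`: it agrees on `V ∩ γ*` with a function that is holomorphic on
an open neighbourhood `V` of `γ(t₀)`. -/
def ExtendableAt (φ : ℂ → ℂ) (f : trace φ → ℂ) (t₀ : ℝ) : Prop :=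
  ∃ V : Set ℂ, IsOpen V ∧ curve φ t₀ ∈ V ∧
    ∃ F : ℂ → ℂ, DifferentiableOn ℂ F V ∧ ∀ w : trace φ, (w : ℂ) ∈ V → F w = f w

/-- The `f ∈ C^k(γ*)` that are real analytic at no point of the curve. -/
def nowhereRealAnalytic (φ : ℂ → ℂ) (k : ℕ∞) : Set (Ck φ k) :=
  {f | ∀ t₀ : ℝ, ¬ RealAnalyticAt φ f.fn t₀}

end JordanCk

end


/-!
For `f` real analytic at `γ(t₀)`, the power series of `f ∘ γ` at `t₀` converges in the complex
plane to some `G`, and `G` composed with a branch of `-i log` and with `φ⁻¹` extends `f`; the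
converse is composition with the analytic map `γ`.

Having a power series at `t₀` whose coefficients satisfy Cauchy estimates with constant `M` passes
to limits, by compactness of the set of admissible coefficients. So the functions analytic at some
point, which may be taken in a countable dense set, form a countable union of closed sets. For
density, the lacunary series `g(t) = ∑ₙ exp (i (n + 1)! t) / (n + 1)! ^ n` is smooth and analytic
nowhere: its derivatives at `0` grow too fast, and its translate by a rational multiple of `2π`
differs from it by a trigonometric polynomial. On a line `c ↦ f + c g` at most one `c` is
exceptional for each point of the countable dense set, so `f + c g` is nowhere analytic for
arbitrarily small `c`.
-/

namespace JordanCk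

open Filter

section BoundedExpansion

variable {𝕜 E : Type*} [NontriviallyNormedField 𝕜] [NormedAddCommGroup E] [NormedSpace 𝕜 E]
  {M : ℕ} {f : 𝕜 → E} {x : 𝕜} {a : ℕ → E}

/-- `f` has a power series expansion at `x` whose coefficients satisfy Cauchy estimates with
constant `M`, and which represents `f` on the ball of radius `1 / (2 * M)`.  The radius enters as
`2 * M * ‖y - x‖ ≤ 1`, so that for `M = 0` it is infinite instead of the junk value `1 / 0 = 0`. -/
structure HasBoundedExpansion (M : ℕ) (f : 𝕜 → E) (x : 𝕜) (a : ℕ → E) : Prop where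
  norm_coeff_le : ∀ n, ‖a n‖ ≤ (M : ℝ) ^ (n + 1)
  hasSum : ∀ y, 2 * M * ‖y - x‖ ≤ 1 → HasSum (fun n => (y - x) ^ n • a n) (f y)

theorem norm_pow_smul_le {z : 𝕜} (hz : 2 * M * ‖z‖ ≤ 1) {n : ℕ} {c : E}
    (hc : ‖c‖ ≤ (M : ℝ) ^ (n + 1)) : ‖z ^ n • c‖ ≤ M * (1 / 2) ^ n := by
  have hz' : M * ‖z‖ ≤ 1 / 2 := by linarith
  calc ‖z ^ n • c‖ = ‖z‖ ^ n * ‖c‖ := by rw [norm_smul, norm_pow]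
    _ ≤ ‖z‖ ^ n * (M : ℝ) ^ (n + 1) := by gcongr
    _ = M * (M * ‖z‖) ^ n := by ring
    _ ≤ M * (1 / 2) ^ n := by gcongr

theorem summable_mul_half_pow (M : ℕ) : Summable fun n : ℕ => (M : ℝ) * (1 / 2) ^ n :=
  summable_geometric_two.mul_left _

theorem eventually_two_mul_norm_sub_le (M : ℕ) (x : 𝕜) :
    ∀ᶠ y in 𝓝 x, 2 * M * ‖y - x‖ ≤ 1 := by
  have h : Continuous fun y => 2 * M * ‖y - x‖ := by fun_prop
  exact (h.tendsto x).eventually_le_const (by simp)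

theorem exists_hasBoundedExpansion (hf : AnalyticAt 𝕜 f x) :
    ∃ M a, HasBoundedExpansion M f x a := by
  obtain ⟨p, hp⟩ := hf
  obtain ⟨ε, hε, hsum⟩ := Metric.eventually_nhds_iff_ball.1 (hasFPowerSeriesAt_iff.1 hp)
  obtain ⟨C, r, -, hr, hC⟩ := p.le_mul_pow_of_radius_pos hp.radius_pos
  obtain ⟨M, hM⟩ := exists_nat_gt (max (max C r) (1 / ε))
  obtain ⟨⟨hCM, hrM⟩, hεM⟩ : (C < M ∧ r < M) ∧ 1 / ε < M := by simpa only [max_lt_iff] using hM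
  refine ⟨M, p.coeff, fun n => ?_, fun y hy => ?_⟩
  · calc ‖p.coeff n‖ = ‖p n‖ := p.norm_apply_eq_norm_coef.symm
      _ ≤ C * r ^ n := hC n
      _ ≤ M * M ^ n := by gcongr
      _ = (M : ℝ) ^ (n + 1) := (pow_succ' _ n).symm
  · have hyε : ‖y - x‖ < ε := by
      have hlt : M * ‖y - x‖ < M * ε := by
        rw [div_lt_iff₀ hε] at hεM
        linarith [show 0 ≤ M * ‖y - x‖ by positivity]
      exact lt_of_mul_lt_mul_left hlt M.cast_nonneg
    simpa only [add_sub_cancel] using hsum (y - x) (mem_ball_zero_iff.2 hyε)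

theorem HasBoundedExpansion.hasFPowerSeriesAt (h : HasBoundedExpansion M f x a) :
    HasFPowerSeriesAt f (fun n => ContinuousMultilinearMap.mkPiRing 𝕜 (Fin n) (a n)) x := by
  refine hasFPowerSeriesAt_iff.2 ?_
  filter_upwards [eventually_two_mul_norm_sub_le M (0 : 𝕜)] with z hz
  simpa [FormalMultilinearSeries.coeff] using h.hasSum (x + z) (by simpa using hz)

theorem HasBoundedExpansion.analyticAt (h : HasBoundedExpansion M f x a) : AnalyticAt 𝕜 f x :=
  h.hasFPowerSeriesAt.analyticAt

theorem HasBoundedExpansion.iteratedDeriv_eq [CompleteSpace E] (h : HasBoundedExpansion M f x a)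
    (n : ℕ) : iteratedDeriv n f x = n.factorial • a n := by
  obtain ⟨r, hr⟩ := h.hasFPowerSeriesAt
  simpa [iteratedDeriv_eq_iteratedFDeriv] using (hr.factorial_smul (1 : 𝕜) n).symm

theorem exists_norm_iteratedDeriv_le [CompleteSpace E] (hf : AnalyticAt 𝕜 f x) :
    ∃ C : ℕ, ∀ n, ‖iteratedDeriv n f x‖ ≤ n.factorial * (C : ℝ) ^ (n + 1) := by
  obtain ⟨M, a, ha⟩ := exists_hasBoundedExpansion hf
  refine ⟨M, fun n => ?_⟩
  rw [ha.iteratedDeriv_eq]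
  exact norm_nsmul_le.trans (by gcongr; exact ha.norm_coeff_le n)

theorem hasBoundedExpansion_tsum [CompleteSpace E] (ha : ∀ n, ‖a n‖ ≤ (M : ℝ) ^ (n + 1)) (x : 𝕜) :
    HasBoundedExpansion M (fun y => ∑' n, (y - x) ^ n • a n) x a :=
  ⟨ha, fun _ hy => (Summable.of_norm_bounded (summable_mul_half_pow M)
    fun n => norm_pow_smul_le hy (ha n)).hasSum⟩

/-- Boundedness of the coefficients makes the passage to the limit a compactness argument: the
coefficient sequences range over a product of closed balls. -/
theorem isClosed_setOf_hasBoundedExpansion [ProperSpace E] (M : ℕ) (x : 𝕜) :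
    IsClosed {f : 𝕜 → E | ∃ a, HasBoundedExpansion M f x a} := by
  let K : Set (ℕ → E) := Set.pi univ fun n => Metric.closedBall 0 ((M : ℝ) ^ (n + 1))
  have mem_K (a : ℕ → E) : a ∈ K ↔ ∀ n, ‖a n‖ ≤ (M : ℝ) ^ (n + 1) := by simp [K]
  have : CompactSpace K := isCompact_iff_compactSpace.1
    (isCompact_univ_pi fun n => isCompact_closedBall _ _)
  have hclosed : IsClosed {q : (𝕜 → E) × K | ∀ y, 2 * M * ‖y - x‖ ≤ 1 →
      q.1 y = ∑' n, (y - x) ^ n • (q.2 : ℕ → E) n} := by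
    simp only [ofPred_forall]
    refine isClosed_iInter fun y => isClosed_iInter fun hy => isClosed_eq (by fun_prop) ?_
    have hcont (n : ℕ) : Continuous fun q : (𝕜 → E) × K => (q.2 : ℕ → E) n :=
      (continuous_apply n).comp (continuous_subtype_val.comp continuous_snd)
    exact continuous_tsum (fun n => (hcont n).const_smul _) (summable_mul_half_pow M) fun n q =>
      norm_pow_smul_le hy ((mem_K _).1 q.2.2 n)
  convert isClosedMap_fst_of_compactSpace _ hclosed
  ext f
  constructor
  · rintro ⟨a, ha⟩
    exact ⟨(f, ⟨a, (mem_K a).2 ha.norm_coeff_le⟩), fun y hy => (ha.hasSum y hy).tsum_eq.symm, rfl⟩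
  · rintro ⟨⟨f, a, haK⟩, hsum, rfl⟩
    have ha := (mem_K a).1 haK
    exact ⟨a, ha, fun y hy => (hsum y hy).symm ▸ (hasBoundedExpansion_tsum ha x).hasSum y hy⟩

end BoundedExpansion

section RealAndComplex

variable {E : Type*} [NormedAddCommGroup E] [NormedSpace ℂ E] {t₀ : ℝ}

theorem analyticAt_comp_ofReal {G : ℂ → E} (hG : AnalyticAt ℂ G t₀) :
    AnalyticAt ℝ (fun t : ℝ => G t) t₀ :=
  hG.restrictScalars.comp (Complex.ofRealCLM.analyticAt t₀)

theorem exists_analyticAt_complex_extension [CompleteSpace E] {f : ℝ → E} (hf : AnalyticAt ℝ f t₀) :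
    ∃ G : ℂ → E, AnalyticAt ℂ G t₀ ∧ ∀ᶠ t : ℝ in 𝓝 t₀, G t = f t := by
  obtain ⟨M, a, ha⟩ := exists_hasBoundedExpansion hf
  refine ⟨_, (hasBoundedExpansion_tsum ha.norm_coeff_le (t₀ : ℂ)).analyticAt, ?_⟩
  filter_upwards [eventually_two_mul_norm_sub_le M t₀] with t ht
  rw [← (ha.hasSum t ht).tsum_eq]
  refine tsum_congr fun n => ?_
  rw [← Complex.ofReal_sub, ← Complex.ofReal_pow, Complex.coe_smul]

end RealAndComplex

section NowhereAnalytic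

variable {𝕜 E F : Type*} [NontriviallyNormedField 𝕜] [NormedAddCommGroup E] [NormedSpace 𝕜 E]
  [NormedAddCommGroup F] [NormedSpace 𝕜 F]

/-- `f` is analytic at no point. -/
def NowhereAnalytic (𝕜 : Type*) {E F : Type*} [NontriviallyNormedField 𝕜] [NormedAddCommGroup E]
    [NormedSpace 𝕜 E] [NormedAddCommGroup F] [NormedSpace 𝕜 F] (f : F → E) : Prop :=
  ∀ x, ¬ AnalyticAt 𝕜 f x

theorem nowhereAnalytic_iff_of_dense [CompleteSpace E] {D : Set F} (hD : Dense D) {f : F → E} :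
    NowhereAnalytic 𝕜 f ↔ ∀ x ∈ D, ¬ AnalyticAt 𝕜 f x := by
  refine ⟨fun h x _ => h x, fun h x hx => ?_⟩
  obtain ⟨y, hy, hyD⟩ := hD.inter_open_nonempty _ (isOpen_analyticAt 𝕜 f) ⟨x, hx⟩
  exact h y hyD hy

theorem isGδ_setOf_nowhereAnalytic [TopologicalSpace.SeparableSpace 𝕜] [ProperSpace E] :
    IsGδ {f : 𝕜 → E | NowhereAnalytic 𝕜 f} := by
  obtain ⟨D, hDc, hD⟩ := TopologicalSpace.exists_countable_dense 𝕜
  have hset : {f : 𝕜 → E | NowhereAnalytic 𝕜 f} =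
      ⋂ x ∈ D, ⋂ M : ℕ, {f | ∃ a, HasBoundedExpansion M f x a}ᶜ := by
    ext f
    simp only [mem_ofPred_eq, nowhereAnalytic_iff_of_dense hD, mem_iInter, mem_compl_iff]
    refine forall₂_congr fun x _ => ⟨fun h M ⟨a, ha⟩ => h ha.analyticAt, fun h hf => ?_⟩
    obtain ⟨M, ha⟩ := exists_hasBoundedExpansion hf
    exact h M ha
  rw [hset]
  exact .biInter hDc fun x _ => .iInter fun M =>
    (isClosed_setOf_hasBoundedExpansion M x).isOpen_compl.isGδ

theorem countable_setOf_not_nowhereAnalytic_add_smul [CompleteSpace E]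
    [TopologicalSpace.SeparableSpace F] {K : Type*} [NormedDivisionRing K] [Module K E]
    [IsBoundedSMul K E] [SMulCommClass 𝕜 K E] (f : F → E) {g : F → E} (hg : NowhereAnalytic 𝕜 g) :
    {c : K | ¬ NowhereAnalytic 𝕜 (f + c • g)}.Countable := by
  obtain ⟨D, hDc, hD⟩ := TopologicalSpace.exists_countable_dense F
  have hpoint (c : K) (hc : ¬ NowhereAnalytic 𝕜 (f + c • g)) :
      ∃ x ∈ D, AnalyticAt 𝕜 (f + c • g) x := by
    simpa [nowhereAnalytic_iff_of_dense hD] using hc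
  choose! x hxD hx using hpoint
  refine MapsTo.countable_of_injOn (f := x) (t := D) hxD (fun c hc d hd hcd => ?_) hDc
  by_contra hne
  have hsub : AnalyticAt 𝕜 ((f + c • g) - (f + d • g)) (x c) := (hx c hc).sub (hcd ▸ hx d hd)
  rw [add_sub_add_left_eq_sub, ← sub_smul] at hsub
  have h := hsub.const_smul (c := (c - d)⁻¹)
  rw [inv_smul_smul₀ (sub_ne_zero.2 hne)] at h
  exact hg _ h

end NowhereAnalytic

section LeftInverse

variable {f g : ℂ → ℂ} {U : Set ℂ} {z : ℂ}

theorem not_eventually_const_of_injOn (hU : IsOpen U) (hinj : InjOn f U) (hz : z ∈ U) :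
    ¬ ∀ᶠ w in 𝓝 z, f w = f z := by
  intro h
  have heq : ∀ᶠ w in 𝓝[≠] z, w = z := by
    filter_upwards [nhdsWithin_le_nhds h, nhdsWithin_le_nhds (hU.mem_nhds hz)] with w hw hwU
    exact hinj hwU hz hw
  obtain ⟨w, hw, hne⟩ := (heq.and self_mem_nhdsWithin).exists
  exact hne hw

theorem nhds_le_map_nhds_of_injOn (hU : IsOpen U) (hf : DifferentiableOn ℂ f U)
    (hinj : InjOn f U) (hz : z ∈ U) : 𝓝 (f z) ≤ map f (𝓝 z) :=
  (hf.analyticAt (hU.mem_nhds hz)).eventually_constant_or_nhds_le_map_nhds.resolve_left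
    (not_eventually_const_of_injOn hU hinj hz)

theorem eventually_deriv_ne_zero_of_injOn (hU : IsOpen U) (hf : DifferentiableOn ℂ f U)
    (hinj : InjOn f U) (hz : z ∈ U) : ∀ᶠ w in 𝓝[≠] z, deriv f w ≠ 0 := by
  have hderiv := (hf.analyticAt (hU.mem_nhds hz)).deriv
  refine hderiv.eventually_eq_zero_or_eventually_ne_zero.resolve_left fun h =>
    not_eventually_const_of_injOn hU hinj hz ?_
  obtain ⟨ε, hε, hball⟩ := Metric.eventually_nhds_iff_ball.1 (h.and (hU.mem_nhds hz))
  filter_upwards [Metric.ball_mem_nhds z hε] with w hw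
  exact Metric.isOpen_ball.is_const_of_deriv_eq_zero (convex_ball z ε).isPreconnected
    (hf.mono fun x hx => (hball x hx).2) (fun x hx => (hball x hx).1) hw
    (Metric.mem_ball_self hε)

theorem tendsto_leftInverse (hU : IsOpen U) (hf : DifferentiableOn ℂ f U)
    (hinj : InjOn f U) (hg : LeftInvOn g f U) (hz : z ∈ U) : Tendsto g (𝓝 (f z)) (𝓝 z) := by
  have h : Tendsto (g ∘ f) (𝓝 z) (𝓝 z) :=
    tendsto_id.congr' (hg.eqOn.symm.eventuallyEq_of_mem (hU.mem_nhds hz))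
  exact (tendsto_map'_iff.2 h).mono_left (nhds_le_map_nhds_of_injOn hU hf hinj hz)

theorem differentiableAt_leftInverse (hU : IsOpen U) (hf : DifferentiableOn ℂ f U)
    (hg : LeftInvOn g f U) (hz : z ∈ U) (hz' : deriv f z ≠ 0) : DifferentiableAt ℂ g (f z) :=
  ((hf.analyticAt (hU.mem_nhds hz)).hasStrictDerivAt.to_local_left_inverse hz'
    (hg.eqOn.eventuallyEq_of_mem (hU.mem_nhds hz))).hasDerivAt.differentiableAt

/-- Near `f z`, the left inverse `g` is differentiable off `f z`, where the singularity is
removable. -/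
theorem analyticAt_leftInverse (hU : IsOpen U) (hf : DifferentiableOn ℂ f U)
    (hinj : InjOn f U) (hg : LeftInvOn g f U) (hz : z ∈ U) : AnalyticAt ℂ g (f z) := by
  have hlim := tendsto_leftInverse hU hf hinj hg hz
  refine Complex.analyticAt_of_differentiable_on_punctured_nhds_of_continuousAt ?_
    (by rwa [ContinuousAt, hg hz])
  have himage : f '' U ∈ 𝓝 (f z) :=
    nhds_le_map_nhds_of_injOn hU hf hinj hz (image_mem_map (hU.mem_nhds hz))
  have hderiv : ∀ᶠ w in 𝓝 (f z), g w ≠ z → deriv f (g w) ≠ 0 := hlim.eventually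
    (eventually_nhdsWithin_iff.1 (eventually_deriv_ne_zero_of_injOn hU hf hinj hz))
  rw [eventually_nhdsWithin_iff]
  filter_upwards [hderiv, himage]
  rintro _ hderiv ⟨x, hx, rfl⟩ hne
  rw [hg hx] at hderiv
  exact differentiableAt_leftInverse hU hf hg hx (hderiv fun h => hne (h ▸ rfl))

end LeftInverse

section Extendability

theorem isOpen_annulus (r R : ℝ) : IsOpen {z : ℂ | r < ‖z‖ ∧ ‖z‖ < R} :=
  (isOpen_lt continuous_const continuous_norm).inter (isOpen_lt continuous_norm continuous_const)

theorem exp_mem_annulus {r R : ℝ} (hr : r < 1) (hR : 1 < R) (t : ℝ) :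
    Complex.exp (t * Complex.I) ∈ {z : ℂ | r < ‖z‖ ∧ ‖z‖ < R} := by
  simpa only [mem_ofPred_eq, Complex.norm_exp_ofReal_mul_I] using ⟨hr, hR⟩

/-- The branch near `exp (t₀ * I)` of the inverse of `t ↦ exp (t * I)` that takes the value `t₀`
at that point. -/
noncomputable def angleNear (t₀ : ℝ) (z : ℂ) : ℂ :=
  t₀ - Complex.I * Complex.log (z * Complex.exp (-(t₀ * Complex.I)))

theorem angleNear_exp_self (t₀ : ℝ) : angleNear t₀ (Complex.exp (t₀ * Complex.I)) = t₀ := by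
  simp [angleNear, ← Complex.exp_add]

theorem analyticAt_angleNear (t₀ : ℝ) :
    AnalyticAt ℂ (angleNear t₀) (Complex.exp (t₀ * Complex.I)) := by
  have hlog : AnalyticAt ℂ (fun z => Complex.log (z * Complex.exp (-(t₀ * Complex.I))))
      (Complex.exp (t₀ * Complex.I)) :=
    AnalyticAt.clog (by fun_prop) (by simp [← Complex.exp_add])
  exact analyticAt_const.sub (analyticAt_const.mul hlog)

theorem exists_angleNear_exp_eq (t₀ t : ℝ) :
    ∃ s : ℝ, angleNear t₀ (Complex.exp (t * Complex.I)) = s ∧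
      Complex.exp (s * Complex.I) = Complex.exp (t * Complex.I) := by
  set z := Complex.exp (t * Complex.I) * Complex.exp (-(t₀ * Complex.I)) with hz
  have hnorm : ‖z‖ = 1 := by
    simp [hz, ← neg_mul, ← Complex.ofReal_neg, Complex.norm_exp_ofReal_mul_I]
  have hexp : Complex.exp (z.arg * Complex.I) = z := by
    simpa [hnorm] using Complex.norm_mul_exp_arg_mul_I z
  refine ⟨t₀ + z.arg, ?_, ?_⟩
  · rw [angleNear, ← hz, Complex.log, hnorm, Real.log_one]
    push_cast
    linear_combination -(z.arg : ℂ) * Complex.I_sq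
  · rw [Complex.ofReal_add, add_mul, Complex.exp_add, hexp, hz, mul_left_comm, ← Complex.exp_add]
    simp

variable {φ : ℂ → ℂ} {f : trace φ → ℂ} {t₀ : ℝ}

theorem extendableAt_iff : ExtendableAt φ f t₀ ↔
    ∃ F : ℂ → ℂ, AnalyticAt ℂ F (curve φ t₀) ∧
      ∀ᶠ w in 𝓝 (curve φ t₀), ∀ t, curve φ t = w → F w = pull φ f t := by
  constructor
  · rintro ⟨V, hV, htV, F, hF, hFf⟩
    refine ⟨F, hF.analyticAt (hV.mem_nhds htV), ?_⟩
    filter_upwards [hV.mem_nhds htV]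
    rintro _ hw t rfl
    exact hFf ⟨curve φ t, mem_range_self t⟩ hw
  · rintro ⟨F, hF, hFf⟩
    obtain ⟨V, hVF, hV, htV⟩ := mem_nhds_iff.1 (hF.eventually_analyticAt.and hFf)
    refine ⟨V, hV, htV, F, fun w hw => (hVF hw).1.differentiableAt.differentiableWithinAt, ?_⟩
    rintro ⟨_, t, rfl⟩ hw
    exact (hVF hw).2 t rfl

theorem analyticAt_curve (hφ : IsAnalyticJordan φ) (t : ℝ) : AnalyticAt ℝ (curve φ) t := by
  obtain ⟨r, R, -, hr, hR, hd, -⟩ := hφ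
  have hφt : AnalyticAt ℂ φ (Complex.exp (t * Complex.I)) :=
    hd.analyticAt ((isOpen_annulus r R).mem_nhds (exp_mem_annulus hr hR t))
  have hexp : AnalyticAt ℂ (fun z : ℂ => Complex.exp (z * Complex.I)) t := by fun_prop
  exact analyticAt_comp_ofReal (G := fun z => φ (Complex.exp (z * Complex.I)))
    (AnalyticAt.fun_comp (f := fun z : ℂ => Complex.exp (z * Complex.I)) hφt hexp)

theorem realAnalyticAt_of_extendableAt (hφ : IsAnalyticJordan φ) (h : ExtendableAt φ f t₀) :
    RealAnalyticAt φ f t₀ := by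
  obtain ⟨F, hF, hFf⟩ := extendableAt_iff.1 h
  have hcurve := analyticAt_curve hφ t₀
  refine (hF.restrictScalars.fun_comp hcurve).congr ?_
  filter_upwards [hcurve.continuousAt.eventually hFf] with t ht
  exact ht t rfl

/-- If `G` extends `pull φ f` from `ℝ` to `ℂ` near `t₀`, the extension of `f` near `γ(t₀)` is
`G ∘ angleNear t₀ ∘ φ⁻¹`. -/
theorem extendableAt_of_realAnalyticAt (hφ : IsAnalyticJordan φ) (h : RealAnalyticAt φ f t₀) :
    ExtendableAt φ f t₀ := by
  obtain ⟨G, hG, hGf⟩ := exists_analyticAt_complex_extension h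
  obtain ⟨r, R, -, hr, hR, hd, hinj⟩ := hφ
  set U : Set ℂ := {z | r < ‖z‖ ∧ ‖z‖ < R}
  have hU : IsOpen U := isOpen_annulus r R
  have hexpU (t : ℝ) : Complex.exp (t * Complex.I) ∈ U := exp_mem_annulus hr hR t
  have hinv : LeftInvOn (Function.invFunOn φ U) φ U := hinj.leftInvOn_invFunOn
  let angle : ℂ → ℂ := fun w => angleNear t₀ (Function.invFunOn φ U w)
  have angle_curve (t : ℝ) : angle (curve φ t) = angleNear t₀ (Complex.exp (t * Complex.I)) :=
    congrArg (angleNear t₀) (hinv (hexpU t))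
  have angle_self : angle (curve φ t₀) = t₀ := by rw [angle_curve, angleNear_exp_self]
  have hangle : AnalyticAt ℂ angle (curve φ t₀) := by
    refine AnalyticAt.fun_comp ?_ (analyticAt_leftInverse hU hd hinj hinv (hexpU t₀))
    rw [curve, hinv (hexpU t₀)]
    exact analyticAt_angleNear t₀
  refine extendableAt_iff.2 ⟨fun w => G (angle w), .fun_comp (by rwa [angle_self]) hangle, ?_⟩
  obtain ⟨ε, hε, hball⟩ := Metric.eventually_nhds_iff_ball.1 hGf
  filter_upwards [hangle.continuousAt.preimage_mem_nhds (Metric.ball_mem_nhds _ hε)]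
  rintro _ hw t rfl
  obtain ⟨s, hs, hst⟩ := exists_angleNear_exp_eq t₀ t
  rw [mem_preimage, angle_self, angle_curve, hs, Metric.mem_ball, Complex.dist_eq,
    ← Complex.ofReal_sub, Complex.norm_real] at hw
  rw [angle_curve, hs, hball s hw]
  exact congrArg f (Subtype.ext (congrArg φ hst))

end Extendability

section TrigSeries

variable {ι : Type*} {ν : ι → ℝ} {a : ι → ℂ}

/-- The trigonometric series with frequencies `ν` and coefficients `a`. -/
noncomputable def trigSeries (ν : ι → ℝ) (a : ι → ℂ) (t : ℝ) : ℂ :=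
  ∑' n, a n * Complex.exp (ν n * t * Complex.I)

/-- The coefficients `a` decay faster than every power of the frequencies `ν`, in the summable
sense that makes all termwise derivatives of `trigSeries ν a` converge. -/
def RapidlyDecaying (ν : ι → ℝ) (a : ι → ℂ) : Prop :=
  ∀ l : ℕ, Summable fun n => |ν n| ^ l * ‖a n‖

theorem RapidlyDecaying.pow_mul (ha : RapidlyDecaying ν a) (l : ℕ) :
    RapidlyDecaying ν fun n => (ν n * Complex.I) ^ l * a n := fun m => by
  simpa [pow_add, mul_assoc] using ha (m + l)

theorem norm_mul_exp_ofReal_mul_I (c : ℂ) (x t : ℝ) :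
    ‖c * Complex.exp (x * t * Complex.I)‖ = ‖c‖ := by
  rw [norm_mul, ← Complex.ofReal_mul, Complex.norm_exp_ofReal_mul_I, mul_one]

theorem RapidlyDecaying.summable (ha : RapidlyDecaying ν a) (t : ℝ) :
    Summable fun n => a n * Complex.exp (ν n * t * Complex.I) :=
  .of_norm <| by simpa only [norm_mul_exp_ofReal_mul_I, pow_zero, one_mul] using ha 0

theorem hasDerivAt_trigSeries (ha : RapidlyDecaying ν a) (t : ℝ) :
    HasDerivAt (trigSeries ν a) (trigSeries ν (fun n => ν n * Complex.I * a n) t) t := by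
  refine hasDerivAt_tsum (g := fun n (s : ℝ) => a n * Complex.exp (ν n * s * Complex.I))
    (g' := fun n (s : ℝ) => ν n * Complex.I * a n * Complex.exp (ν n * s * Complex.I))
    (ha 1) (fun n s => ?_) (fun n s => ?_) (ha.summable 0) t
  · have harg : HasDerivAt (fun s : ℝ => (ν n * s * Complex.I : ℂ)) (ν n * Complex.I) s := by
      simpa using ((Complex.ofRealCLM.hasDerivAt (x := s)).const_mul (ν n : ℂ)).mul_const Complex.I
    exact (harg.cexp.const_mul (a n)).congr_deriv (by ring)
  · rw [norm_mul_exp_ofReal_mul_I]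
    simp

theorem iteratedDeriv_trigSeries (ha : RapidlyDecaying ν a) (l : ℕ) :
    iteratedDeriv l (trigSeries ν a) = trigSeries ν fun n => (ν n * Complex.I) ^ l * a n := by
  induction l with
  | zero => simp
  | succ l ih =>
    funext t
    rw [iteratedDeriv_succ, ih, (hasDerivAt_trigSeries (ha.pow_mul l) t).deriv]
    simp only [pow_succ', mul_assoc]

theorem contDiff_trigSeries (ha : RapidlyDecaying ν a) : ContDiff ℝ ∞ (trigSeries ν a) :=
  contDiff_of_differentiable_iteratedDeriv fun l _ => by
    rw [iteratedDeriv_trigSeries ha]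
    exact fun t => (hasDerivAt_trigSeries (ha.pow_mul l) t).differentiableAt

theorem exp_mul_add_mul_I (x s t : ℝ) : Complex.exp (x * (t + s : ℝ) * Complex.I) =
    Complex.exp (x * s * Complex.I) * Complex.exp (x * t * Complex.I) := by
  rw [← Complex.exp_add]
  push_cast
  ring_nf

theorem periodic_trigSeries (a : ι → ℂ) {s : ℝ}
    (hs : ∀ n, Complex.exp (ν n * s * Complex.I) = 1) : Function.Periodic (trigSeries ν a) s :=
  fun t => by simp only [trigSeries, exp_mul_add_mul_I, hs, one_mul]

/-- The translate by `s` differs from the series by a trigonometric polynomial. -/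
theorem analyticAt_zero_trigSeries (ha : RapidlyDecaying ν a) {s : ℝ}
    (hs : {n | Complex.exp (ν n * s * Complex.I) ≠ 1}.Finite)
    (h : AnalyticAt ℝ (trigSeries ν a) s) : AnalyticAt ℝ (trigSeries ν a) 0 := by
  let term (n : ι) (t : ℝ) : ℂ := a n * Complex.exp (ν n * t * Complex.I)
  have hterm (n : ι) (t : ℝ) : AnalyticAt ℝ (term n) t :=
    analyticAt_comp_ofReal (G := fun z => a n * Complex.exp (ν n * z * Complex.I)) (by fun_prop)
  have hdiff (t : ℝ) : trigSeries ν a t =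
      trigSeries ν a (t + s) - ∑ n ∈ hs.toFinset, (term n (t + s) - term n t) := by
    rw [← tsum_eq_sum (L := .unconditional ι), (ha.summable (t + s)).tsum_sub (ha.summable t)]
    · simp [trigSeries]
    · intro n hn
      have hn1 : Complex.exp (ν n * s * Complex.I) = 1 := by simpa using hn
      simp only [term, exp_mul_add_mul_I, hn1, one_mul, sub_self]
  have hshift {g : ℝ → ℂ} (hg : AnalyticAt ℝ g s) : AnalyticAt ℝ (fun t => g (t + s)) 0 :=
    AnalyticAt.fun_comp (f := (· + s)) (by simpa using hg) (by fun_prop)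
  rw [funext hdiff]
  exact (hshift h).fun_sub
    (Finset.analyticAt_fun_sum _ fun n _ => (hshift (hterm n s)).fun_sub (hterm n 0))

theorem le_norm_iteratedDeriv_trigSeries {b : ι → ℝ} (hν : ∀ n, 0 ≤ ν n) (hb : ∀ n, 0 ≤ b n)
    (hdecay : RapidlyDecaying ν fun n => (b n : ℂ)) (l : ℕ) (m : ι) :
    ν m ^ l * b m ≤ ‖iteratedDeriv l (trigSeries ν fun n => (b n : ℂ)) 0‖ := by
  have hsum : Summable fun n => ν n ^ l * b n := by
    simpa [abs_of_nonneg, hν, hb] using hdecay l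
  have hnonneg (n : ι) : 0 ≤ ν n ^ l * b n := mul_nonneg (pow_nonneg (hν n) l) (hb n)
  have hderiv : iteratedDeriv l (trigSeries ν fun n => (b n : ℂ)) 0 =
      Complex.I ^ l * (∑' n, ν n ^ l * b n : ℝ) := by
    rw [iteratedDeriv_trigSeries hdecay, trigSeries, Complex.ofReal_tsum, ← tsum_mul_left]
    refine tsum_congr fun n => ?_
    simp
    ring
  rw [hderiv, norm_mul, norm_pow, Complex.norm_I, one_pow, one_mul,
    Complex.norm_of_nonneg (tsum_nonneg hnonneg)]
  exact hsum.le_tsum m fun n _ => hnonneg n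

end TrigSeries

section FactorialSeries

open scoped Nat

/-- The lacunary series `∑ₙ exp ((n + 1)! t I) / (n + 1)! ^ n`, an example of a smooth nowhere
analytic function.  With `(n + 1)!` rather than `n !` no frequency is repeated. -/
noncomputable def factorialSeries : ℝ → ℂ :=
  trigSeries (fun n : ℕ => ((n + 1)! : ℝ)) fun n : ℕ => ((((n + 1)! : ℝ) ^ n)⁻¹ : ℝ)

theorem rapidlyDecaying_factorialSeries :
    RapidlyDecaying (fun n : ℕ => ((n + 1)! : ℝ)) fun n : ℕ => ((((n + 1)! : ℝ) ^ n)⁻¹ : ℝ) := by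
  intro l
  have hsum := (summable_nat_add_iff 1).2 (Real.summable_pow_div_factorial 1)
  refine hsum.of_norm_bounded_eventually_nat ?_
  filter_upwards [eventually_gt_atTop l] with n hn
  have hone : (1 : ℝ) ≤ (n + 1)! := mod_cast (n + 1).factorial_pos
  have hpos : (0 : ℝ) < (n + 1)! := by positivity
  simp only [Complex.norm_real, norm_mul, norm_inv, norm_pow, Real.norm_natCast, abs_of_pos hpos,
    one_pow]
  rw [← div_eq_mul_inv, div_le_div_iff₀ (by positivity) hpos, one_mul, ← pow_succ]
  exact pow_le_pow_right₀ hone hn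

theorem exists_factorial_mul_pow_lt (C : ℕ) :
    ∃ n : ℕ, (2 * (n + 1))! * C ^ (2 * (n + 1) + 1) < (n + 1)! ^ (n + 2) := by
  obtain rfl | hC := C.eq_zero_or_pos
  · exact ⟨0, by simp⟩
  set n := 2 * C ^ 3 + 1
  have hn : 2 * C ^ 3 < n ! := (Nat.lt_succ_self _).trans_le n.self_le_factorial
  refine ⟨n, ?_⟩
  calc (2 * (n + 1))! * C ^ (2 * (n + 1) + 1)
      ≤ (2 * (n + 1)) ^ (n + 1) * (n + 1)! * C ^ (3 * (n + 1)) := by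
        gcongr
        · exact Nat.factorial_two_mul_le _
        · omega
    _ = ((n + 1) * (2 * C ^ 3)) ^ (n + 1) * (n + 1)! := by
        rw [pow_mul, mul_right_comm, ← mul_pow]
        ring_nf
    _ < ((n + 1) * n !) ^ (n + 1) * (n + 1)! := by gcongr
    _ = (n + 1)! ^ (n + 2) := by rw [← Nat.factorial_succ, ← pow_succ]

theorem not_analyticAt_factorialSeries_zero : ¬ AnalyticAt ℝ factorialSeries 0 := by
  intro h
  obtain ⟨C, hC⟩ := exists_norm_iteratedDeriv_le h
  obtain ⟨n, hn⟩ := exists_factorial_mul_pow_lt C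
  refine hn.not_ge ?_
  have hlower := le_norm_iteratedDeriv_trigSeries (fun n => by positivity) (fun n => by positivity)
    rapidlyDecaying_factorialSeries (2 * (n + 1)) n
  have hpow : ((n + 1)! : ℝ) ^ (2 * (n + 1)) * (((n + 1)! : ℝ) ^ n)⁻¹ = (n + 1)! ^ (n + 2) := by
    rw [← div_eq_mul_inv, div_eq_iff (by positivity), ← pow_add]
    ring_nf
  exact_mod_cast hpow ▸ hlower.trans (hC _)

theorem exp_natCast_mul_two_pi_mul_rat {q : ℚ} {N : ℕ} (hN : q.den ∣ N) :
    Complex.exp ((N : ℝ) * (2 * Real.pi * q : ℝ) * Complex.I) = 1 := by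
  obtain ⟨d, rfl⟩ := hN
  have hq : (q : ℂ) * q.den = q.num := mod_cast q.mul_den_eq_num
  refine Complex.exp_eq_one_iff.2 ⟨d * q.num, ?_⟩
  push_cast
  linear_combination 2 * Real.pi * d * Complex.I * hq

theorem periodic_factorialSeries : Function.Periodic factorialSeries (2 * Real.pi) :=
  periodic_trigSeries _ fun n => by
    simpa using exp_natCast_mul_two_pi_mul_rat (q := 1) (one_dvd (n + 1).factorial)

theorem not_analyticAt_factorialSeries (q : ℚ) :
    ¬ AnalyticAt ℝ factorialSeries (2 * Real.pi * q) := by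
  refine fun h => not_analyticAt_factorialSeries_zero
    (analyticAt_zero_trigSeries rapidlyDecaying_factorialSeries ?_ h)
  refine (finite_lt_nat q.den).subset fun n hn => ?_
  contrapose! hn
  exact not_not.2 (exp_natCast_mul_two_pi_mul_rat
    (Nat.dvd_factorial q.den_pos (not_lt.1 hn |>.trans n.le_succ)))

theorem denseRange_two_pi_mul_rat : DenseRange fun q : ℚ => 2 * Real.pi * (q : ℝ) :=
  (mul_left_surjective₀ Real.two_pi_pos.ne').denseRange.comp Rat.denseRange_cast (by fun_prop)

theorem nowhereAnalytic_factorialSeries : NowhereAnalytic ℝ factorialSeries :=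
  (nowhereAnalytic_iff_of_dense denseRange_two_pi_mul_rat).2 <|
    forall_mem_range.2 not_analyticAt_factorialSeries

end FactorialSeries

section Topology

variable {φ : ℂ → ℂ} {k : ℕ∞}

theorem withSeminorms_ckSeminorm (φ : ℂ → ℂ) (k : ℕ∞) : WithSeminorms (ckSeminorm φ k) := ⟨rfl⟩

instance : IsTopologicalAddGroup (Ck φ k) := (withSeminorms_ckSeminorm φ k).topologicalAddGroup

instance : ContinuousSMul ℂ (Ck φ k) := (withSeminorms_ckSeminorm φ k).continuousSMul

/-- `pull φ` as a linear map on `C^k(γ*)`. -/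
noncomputable def pullLinear (φ : ℂ → ℂ) (k : ℕ∞) : Ck φ k →ₗ[ℂ] ℝ → ℂ where
  toFun f := pull φ f.fn
  map_add' _ _ := rfl
  map_smul' _ _ := rfl

theorem norm_pull_le (f : Ck φ k) (t : ℝ) : ‖pull φ f.fn t‖ ≤ ckSeminorm φ k ⟨0, zero_le⟩ f :=
  calc ‖pull φ f.fn t‖ = ‖iteratedDeriv 0 (pull φ f.fn) t‖ := by rw [iteratedDeriv_zero]
    _ ≤ ckSeminorm φ k ⟨0, zero_le⟩ f := le_ciSup (bddAbove_deriv f zero_le) t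

theorem continuous_pullLinear : Continuous (pullLinear φ k) :=
  continuous_pi fun t => (withSeminorms_ckSeminorm φ k).continuous_normedSpace_rng _
    ((LinearMap.proj t).comp (pullLinear φ k))
    ⟨{⟨0, zero_le⟩}, 1, fun f => by
      rw [Finset.sup_singleton, one_smul]
      exact norm_pull_le f t⟩

theorem isGδ_nowhereRealAnalytic : IsGδ (nowhereRealAnalytic φ k) :=
  (isGδ_setOf_nowhereAnalytic (𝕜 := ℝ) (E := ℂ)).preimage continuous_pullLinear

theorem exists_pull_eq (hφ : IsAnalyticJordan φ) {h : ℝ → ℂ}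
    (hper : Function.Periodic h (2 * Real.pi)) : ∃ f : trace φ → ℂ, pull φ f = h := by
  obtain ⟨r, R, -, hr, hR, -, hinj⟩ := hφ
  have hfac : h.FactorsThrough (rangeFactorization (curve φ)) := by
    intro s t hst
    have hexp := hinj (exp_mem_annulus hr hR s) (exp_mem_annulus hr hR t) (congrArg Subtype.val hst)
    obtain ⟨n, hn⟩ := Complex.exp_eq_exp_iff_exists_int.1 hexp
    have hn' : (s : ℂ) = t + n * (2 * Real.pi) :=
      mul_right_cancel₀ Complex.I_ne_zero (by rw [hn]; ring)
    rw [show s = t + n * (2 * Real.pi) from mod_cast hn', hper.int_mul n t]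
  exact ⟨Function.extend (rangeFactorization (curve φ)) h 0, funext (hfac.extend_apply 0)⟩

theorem nonempty_nowhereRealAnalytic (hφ : IsAnalyticJordan φ) (k : ℕ∞) :
    (nowhereRealAnalytic φ k).Nonempty := by
  obtain ⟨f, hf⟩ := exists_pull_eq hφ periodic_factorialSeries
  have hsmooth : ContDiff ℝ k (pull φ f) := by
    rw [hf]
    exact (contDiff_trigSeries rapidlyDecaying_factorialSeries).of_le (mod_cast le_top)
  refine ⟨⟨f, hsmooth⟩, fun t ht => nowhereAnalytic_factorialSeries t ?_⟩
  rwa [← hf]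

theorem dense_nowhereRealAnalytic (hφ : IsAnalyticJordan φ) (k : ℕ∞) :
    Dense (nowhereRealAnalytic φ k) := by
  obtain ⟨g, hg⟩ := nonempty_nowhereRealAnalytic hφ k
  intro f
  have hcountable : {c : ℂ | f + c • g ∉ nowhereRealAnalytic φ k}.Countable :=
    countable_setOf_not_nowhereAnalytic_add_smul (𝕜 := ℝ) (pull φ f.fn) (g := pull φ g.fn) hg
  have hcont : Continuous fun c : ℂ => f + c • g := by fun_prop
  simpa using hcont.continuousWithinAt.mem_closure (hcountable.dense_compl ℝ 0)
    (t := nowhereRealAnalytic φ k) fun c hc => not_not.1 hc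

end Topology

end JordanCk

theorem theorem5p11 (φ : ℂ → ℂ) (hφ : JordanCk.IsAnalyticJordan φ) :
    (∀ (f : JordanCk.trace φ → ℂ) (t₀ : ℝ),
      JordanCk.RealAnalyticAt φ f t₀ ↔ JordanCk.ExtendableAt φ f t₀) ∧
    ∀ k : ℕ∞,
      Dense (JordanCk.nowhereRealAnalytic φ k) ∧ IsGδ (JordanCk.nowhereRealAnalytic φ k) :=
  ⟨fun _ _ => ⟨JordanCk.extendableAt_of_realAnalyticAt hφ,
      JordanCk.realAnalyticAt_of_extendableAt hφ⟩,
    fun k => ⟨JordanCk.dense_nowhereRealAnalytic hφ k, JordanCk.isGδ_nowhereRealAnalytic⟩⟩
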